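/- **Proposition 3.** Consider the open online dial-a-ride problem on the real line: a server of capacity $c\in\{1,2,\dots\}\cup\{\infty\}$ starts in the origin $0$ at time $0$ and moves with speed at most $1$. For a request sequence $\sigma=(r_1,\dots,r_n)$, $n\ge 1$, with $r_i=(a_i,b_i;t_i)$, $a_i,b_i\in\mathbb{R}$ and $0<t_1<\dots<t_n$, request $r_i$ becomes known at time $t_i$; it is served by loading it at $a_i$ no earlier than $t_i$ and transporting it to $b_i$, where alone it may be unloaded (non-preemption). At most $c$ requests may be on board simultaneously, and the server need not return to the origin. Let $\mathrm{Opt}(t)$ be the least completion time of an offline schedule serving all requests released no later than $t$ (with $\mathrm{Opt}(t)=0$ if there are none), and let $\mathrm{Opt}(\sigma)=\mathrm{Opt}(t_n)$. For a set $R$ of released requests and $x\in\mathbb{R}$, let $S(R,x)$ be a shortest schedule that starts in $x$ and serves all requests in $R$. For $\alpha\ge 0$, the algorithm $\textsc{Lazy}(\alpha)$ is as follows. Whenever a request arrives, at time $t$, and the server can deliver all requests on board and return to the origin by time $\alpha\cdot\mathrm{Opt}(t)$, it aborts what it is doing and does so in a shortest way; otherwise it continues what it is doing. Whenever the server is idle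 (it has completed a command, or it has nothing to do and a request arrives that does not make it return to the origin), at time $t$: if $t<\alpha\cdot\mathrm{Opt}(t)$, it waits at its position until time $\alpha\cdot\mathrm{Opt}(t)$; otherwise, if the set $R_t$ of released and unserved requests is nonempty, it follows $S(R_t,p_t)$, where $p_t$ is its position; otherwise it rests. A request arriving at the very moment at which a command is completed is handled first. Let $\mathrm{Alg}(\sigma)$ be the time at which $\textsc{Lazy}(\alpha)$ has served all requests of $\sigma$. Then, for every $\alpha\in[0,1)$, every capacity $c\in\{1,2,\dots\}\cup\{\infty\}$, and every choice among shortest schedules in the algorithm, the competitive ratio of $\textsc{Lazy}(\alpha)$ satisfies $$\sup_{\sigma}\frac{\mathrm{Alg}(\sigma)}{\mathrm{Opt}(\sigma)}\;\ge\;2+\alpha+\frac{1-\alpha}{2+3\alpha}.$$ -/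

import Mathlib

open scoped ENNReal

noncomputable section

namespace DialARide

/-- A sequence `r₁, …, rₙ` of requests `rᵢ = (src i, dst i; release i)` on the real line, with
release times `0 < release r₁ < ⋯ < release rₙ` (indexed by `Fin n`, i.e. from `0`). -/
structure RequestSeq where
  n : ℕ
  src : Fin n → ℝ
  dst : Fin n → ℝ
  release : Fin n → ℝ
  release_pos : ∀ i, 0 < release i
  release_strictMono : StrictMono release

/-- The data of a schedule: the position of the server, the times at which requests are collected
and unloaded (meaningful only for the requests that the schedule deals with), and the time at which
the schedule ends.  All times are relative to the start of the schedule. -/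
structure Schedule (n : ℕ) where
  pos : ℝ → ℝ
  load : Fin n → ℝ
  unload : Fin n → ℝ
  finish : ℝ

/-- The server starts in `x`, moves with speed at most `1`, and the schedule has nonnegative
length. -/
structure Schedule.IsMotion {n : ℕ} (S : Schedule n) (x : ℝ) : Prop where
  start : S.pos 0 = x
  speed : ∀ s t, 0 ≤ s → s ≤ t → |S.pos t - S.pos s| ≤ t - s
  finish_nonneg : 0 ≤ S.finish

/-- `S` is a non-preemptive schedule that starts in `x` with an empty server of capacity `c` and
serves all requests in `R`, the request `i` being available for collection from time `rel i` on.

`capacity` bounds the number of requests on board at any time.  A request that is collected and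
unloaded at the same instant is not seen by it; `room` says that it, too, needs a free slot, besides
the requests that are carried through this instant. -/
structure Schedule.Serves (c : ℕ∞) (σ : RequestSeq) (rel : Fin σ.n → ℝ) (R : Finset (Fin σ.n))
    (x : ℝ) (S : Schedule σ.n) : Prop extends S.IsMotion x where
  load_nonneg : ∀ i ∈ R, 0 ≤ S.load i
  rel_le_load : ∀ i ∈ R, rel i ≤ S.load i
  load_le_unload : ∀ i ∈ R, S.load i ≤ S.unload i
  unload_le_finish : ∀ i ∈ R, S.unload i ≤ S.finish
  pos_load : ∀ i ∈ R, S.pos (S.load i) = σ.src i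
  pos_unload : ∀ i ∈ R, S.pos (S.unload i) = σ.dst i
  capacity : ∀ t, ((R.filter fun j => S.load j ≤ t ∧ t < S.unload j).card : ℕ∞) ≤ c
  room : ∀ i ∈ R,
    ((R.filter fun j => S.load j < S.load i ∧ S.load i < S.unload j).card : ℕ∞) < c

/-- Starting in `x` with exactly the requests in `L` on board, `S` delivers all of them, collects
nothing, and ends in the origin. -/
structure Schedule.Delivers (σ : RequestSeq) (L : Finset (Fin σ.n)) (x : ℝ)
    (S : Schedule σ.n) : Prop extends S.IsMotion x where
  unload_nonneg : ∀ i ∈ L, 0 ≤ S.unload i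
  unload_le_finish : ∀ i ∈ L, S.unload i ≤ S.finish
  pos_unload : ∀ i ∈ L, S.pos (S.unload i) = σ.dst i
  pos_finish : S.pos S.finish = 0

/-- `S` is a shortest schedule with the property `P`. -/
def Schedule.IsShortest {n : ℕ} (P : Schedule n → Prop) (S : Schedule n) : Prop :=
  P S ∧ ∀ S', P S' → S.finish ≤ S'.finish

/-- The offline optimum for the requests in `R`: the least completion time of a schedule that starts
in the origin at time `0`, serves all of `R`, and collects no request before its release. -/
def optOf (c : ℕ∞) (σ : RequestSeq) (R : Finset (Fin σ.n)) : ℝ :=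
  sInf {T | ∃ S : Schedule σ.n, S.Serves c σ σ.release R 0 ∧ S.finish = T}

/-- `Opt(t)`: the offline optimum over all requests released not later than `t`. -/
def opt (c : ℕ∞) (σ : RequestSeq) (t : ℝ) : ℝ :=
  optOf c σ (Finset.univ.filter fun i => σ.release i ≤ t)

/-- A way of choosing among shortest schedules.  `sched σ R x` is the schedule `S(R, x)`, a shortest
schedule from `x` that serves `R` (all of whose requests are released already), and `back σ L x` is
an optimal way to deliver the loaded requests `L` from `x` and to return to the origin. -/
structure TieBreaking (c : ℕ∞) where
  sched : (σ : RequestSeq) → Finset (Fin σ.n) → ℝ → Schedule σ.n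
  back : (σ : RequestSeq) → Finset (Fin σ.n) → ℝ → Schedule σ.n
  sched_shortest : ∀ σ R x,
    Schedule.IsShortest (Schedule.Serves c σ (fun _ => 0) R x) (sched σ R x)
  back_shortest : ∀ σ L x, Schedule.IsShortest (Schedule.Delivers σ L x) (back σ L x)

/-- What the server is doing.  `rest` means that it is idle and has nothing to do. -/
inductive Command (n : ℕ) where
  | rest
  | waitUntil (t' : ℝ)
  | deliverAndReturn (S : Schedule n)
  | followSchedule (R : Finset (Fin n)) (S : Schedule n)

/-- The state of the online algorithm: the number of requests that have arrived so far, the command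
being executed, and the time at which it was issued together with the position, the loaded requests
and the served requests at that time. -/
structure State (n : ℕ) where
  arrived : ℕ
  cmd : Command n
  start : ℝ
  pos : ℝ
  loaded : Finset (Fin n)
  served : Finset (Fin n)

namespace State

variable {n : ℕ}

/-- Position of the server at time `t` (from the start of the current command on, as long as the
command is not aborted). -/
def posAt (q : State n) (t : ℝ) : ℝ :=
  match q.cmd with
  | .rest => q.pos
  | .waitUntil _ => q.pos
  | .deliverAndReturn S => S.pos (t - q.start)
  | .followSchedule _ S => S.pos (t - q.start)

/-- The requests on board at time `t`. -/
def loadedAt (q : State n) (t : ℝ) : Finset (Fin n) :=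
  match q.cmd with
  | .rest => q.loaded
  | .waitUntil _ => q.loaded
  | .deliverAndReturn S => q.loaded.filter fun i => t < q.start + S.unload i
  | .followSchedule R S =>
      R.filter fun i => q.start + S.load i ≤ t ∧ t < q.start + S.unload i

/-- The requests that have been served by time `t`. -/
def servedAt (q : State n) (t : ℝ) : Finset (Fin n) :=
  match q.cmd with
  | .rest => q.served
  | .waitUntil _ => q.served
  | .deliverAndReturn S => q.served ∪ q.loaded.filter fun i => q.start + S.unload i ≤ t
  | .followSchedule R S => q.served ∪ R.filter fun i => q.start + S.unload i ≤ t

/-- The time at which the current command is completed, i.e. at which the server becomes idle. -/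
def endTime (q : State n) : WithTop ℝ :=
  match q.cmd with
  | .rest => ⊤
  | .waitUntil t' => (t' : ℝ)
  | .deliverAndReturn S => (q.start + S.finish : ℝ)
  | .followSchedule _ S => (q.start + S.finish : ℝ)

/-- Abort the current command at time `t` and execute `cmd` instead. -/
def execute (q : State n) (t : ℝ) (cmd : Command n) : State n where
  arrived := q.arrived
  cmd := cmd
  start := t
  pos := q.posAt t
  loaded := q.loadedAt t
  served := q.servedAt t

/-- The unserved ones among the requests that have arrived. -/
def unservedAt (q : State n) (t : ℝ) : Finset (Fin n) :=
  (Finset.univ.filter fun i : Fin n => (i : ℕ) < q.arrived) \ q.servedAt t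

end State

/-- The part of `Lazy(α)` that is invoked when the server is idle at time `t`. -/
def uponIdle {c : ℕ∞} (τ : TieBreaking c) (α : ℝ) (σ : RequestSeq) (t : ℝ) (q : State σ.n) :
    State σ.n :=
  if t < α * opt c σ t then
    q.execute t (.waitUntil (α * opt c σ t))
  else if q.unservedAt t ≠ ∅ then
    q.execute t (.followSchedule (q.unservedAt t) (τ.sched σ (q.unservedAt t) (q.posAt t)))
  else
    q.execute t .rest

/-- The part of `Lazy(α)` that is invoked when the next request arrives, at time `t`.  If the server
is at rest and is not sent back to the origin, it remains idle and the other part of the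
algorithm is invoked. -/
def uponRequest {c : ℕ∞} (τ : TieBreaking c) (α : ℝ) (σ : RequestSeq) (t : ℝ) (q : State σ.n) :
    State σ.n :=
  let q' : State σ.n := { q with arrived := q.arrived + 1 }
  if t + (τ.back σ (q.loadedAt t) (q.posAt t)).finish ≤ α * opt c σ t then
    q'.execute t (.deliverAndReturn (τ.back σ (q.loadedAt t) (q.posAt t)))
  else
    match q.cmd with
    | .rest => uponIdle τ α σ t q'
    | _ => q'

/-- Process the next event: the arrival of the next request or the completion of the current
command, whichever is earlier (the arrival, if both happen at the same time).  When no event is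
left, the state does not change any more. -/
def step {c : ℕ∞} (τ : TieBreaking c) (α : ℝ) (σ : RequestSeq) (q : State σ.n) : State σ.n :=
  open Classical in
  if h : ∃ h : q.arrived < σ.n, (σ.release ⟨q.arrived, h⟩ : WithTop ℝ) ≤ q.endTime then
    uponRequest τ α σ (σ.release ⟨q.arrived, h.choose⟩) q
  else
    if h' : q.endTime = ⊤ then q else uponIdle τ α σ (q.endTime.untop h') q

/-- At time `0` the server is idle in the origin, and no request has arrived. -/
def initState (n : ℕ) : State n where
  arrived := 0
  cmd := .rest
  start := 0
  pos := 0
  loaded := ∅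
  served := ∅

/-- The state of `Lazy(α)` after `k` events. -/
def run {c : ℕ∞} (τ : TieBreaking c) (α : ℝ) (σ : RequestSeq) (k : ℕ) : State σ.n :=
  (step τ α σ)^[k] (initState σ.n)

/-- All requests have arrived and have been served by time `T` in the run of `Lazy(α)`.  (After the
last arrival no command is aborted any more.) -/
def CompletedBy {c : ℕ∞} (τ : TieBreaking c) (α : ℝ) (σ : RequestSeq) (T : ℝ) : Prop :=
  ∃ k, (run τ α σ k).arrived = σ.n ∧ (run τ α σ k).start ≤ T ∧
    (run τ α σ k).servedAt T = Finset.univ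

/-- The completion time of `Lazy(α)` on `σ` (infinite if `σ` is never completed). -/
def lazyCost {c : ℕ∞} (τ : TieBreaking c) (α : ℝ) (σ : RequestSeq) : ℝ≥0∞ :=
  ⨅ (T : ℝ) (_ : CompletedBy τ α σ T), ENNReal.ofReal T

/-- The strict competitive ratio `sup_σ Alg(σ) / Opt(σ)` of `Lazy(α)` for server capacity `c` on the
line, over all nonempty request sequences. -/
def competitiveRatio {c : ℕ∞} (τ : TieBreaking c) (α : ℝ) : ℝ≥0∞ :=
  ⨆ (σ : RequestSeq) (_ : 0 < σ.n),
    lazyCost τ α σ / ENNReal.ofReal (optOf c σ Finset.univ)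

/-- A path of speed at most `1` that visits bounded prescribed points at well separated times. -/
theorem exists_path (D : ℝ) (hD : 0 < D) (p : ℕ → ℝ) (hp : ∀ k m, |p k - p m| ≤ D) :
    ∃ g : ℝ → ℝ, (∀ s t, s ≤ t → |g t - g s| ≤ t - s) ∧ ∀ k : ℕ, g (k * D) = p k := by
  have key : ∀ k : ℕ, p ⌊(k * D) / D⌋₊ = p k := by
    intro k
    rw [mul_div_cancel_right₀ _ hD.ne', Nat.floor_natCast]
  have hL : LipschitzOnWith 1 (fun t => p ⌊t / D⌋₊) (Set.range fun k : ℕ => (k : ℝ) * D) := by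
    refine LipschitzOnWith.of_dist_le_mul ?_
    rintro _ ⟨k, rfl⟩ _ ⟨m, rfl⟩
    simp only [key, Real.dist_eq, NNReal.coe_one, one_mul]
    rcases eq_or_ne k m with rfl | hkm
    · simp
    · rw [← sub_mul, abs_mul, abs_of_pos hD]
      have : (1 : ℝ) ≤ |(k : ℝ) - m| := by
        have : (1 : ℤ) ≤ |(k : ℤ) - m| := Int.one_le_abs (by omega)
        exact_mod_cast this
      nlinarith [hp k m]
  obtain ⟨g, hg, hge⟩ := hL.extend_real
  refine ⟨g, fun s t hst => ?_, fun k => ?_⟩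
  · have := hg.dist_le_mul t s
    simpa [Real.dist_eq, abs_of_nonneg (sub_nonneg.2 hst)] using this
  · rw [← hge ⟨k, rfl⟩]; exact key k

/-- A shortest schedule exists if the schedules in question can be normalised to a closed set of
bounded data (for the product topology). -/
theorem exists_shortest_of_closed {n : ℕ} (P : Schedule n → Prop) (x : ℝ)
    (C : Set ((ℝ → ℝ) × (Fin n → ℝ) × (Fin n → ℝ) × ℝ)) (hC : IsClosed C)
    (hC1 : ∀ z ∈ C, (∀ t, |z.1 t - x| ≤ |t|) ∧ (∀ i, 0 ≤ z.2.1 i ∧ z.2.1 i ≤ z.2.2.2) ∧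
      (∀ i, 0 ≤ z.2.2.1 i ∧ z.2.2.1 i ≤ z.2.2.2) ∧ 0 ≤ z.2.2.2)
    (hCP : ∀ z ∈ C, P ⟨z.1, z.2.1, z.2.2.1, z.2.2.2⟩)
    (hPC : ∀ S, P S → ∃ z ∈ C, z.2.2.2 = S.finish)
    (hne : ∃ S, P S) : ∃ S, Schedule.IsShortest P S := by
  obtain ⟨S₀, hS₀⟩ := hne
  obtain ⟨z₀, hz₀, hf₀⟩ := hPC S₀ hS₀
  set f₀ := S₀.finish
  let B : Set ((ℝ → ℝ) × (Fin n → ℝ) × (Fin n → ℝ) × ℝ) :=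
    (Set.univ.pi fun t => Set.Icc (x - |t|) (x + |t|)) ×ˢ (Set.univ.pi fun _ => Set.Icc 0 f₀) ×ˢ
      (Set.univ.pi fun _ => Set.Icc 0 f₀) ×ˢ Set.Icc 0 f₀
  have hB : IsCompact B :=
    (isCompact_univ_pi fun _ => isCompact_Icc).prod
      ((isCompact_univ_pi fun _ => isCompact_Icc).prod
        ((isCompact_univ_pi fun _ => isCompact_Icc).prod isCompact_Icc))
  have hmem : ∀ z ∈ C, z.2.2.2 ≤ f₀ → z ∈ B := by
    intro z hz hzf
    obtain ⟨h1, h2, h3, h4⟩ := hC1 z hz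
    refine ⟨fun t _ => ?_, fun i _ => ⟨(h2 i).1, (h2 i).2.trans hzf⟩,
      fun i _ => ⟨(h3 i).1, (h3 i).2.trans hzf⟩, h4, hzf⟩
    have := abs_le.1 (h1 t)
    constructor <;> linarith
  obtain ⟨z, hz, hmin⟩ := (hB.inter_left hC).exists_isMinOn ⟨z₀, hz₀, hmem z₀ hz₀ hf₀.le⟩
    (f := fun z => z.2.2.2) (by fun_prop)
  refine ⟨_, hCP z hz.1, fun S' hS' => ?_⟩
  obtain ⟨z', hz', hf'⟩ := hPC S' hS'
  rw [← hf']
  rcases le_or_gt z'.2.2.2 f₀ with h | h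
  · exact hmin ⟨hz', hmem z' hz' h⟩
  · exact (hz.2.2.2.2.2).trans h.le

theorem exists_back (σ : RequestSeq) (L : Finset (Fin σ.n)) (x : ℝ) :
    ∃ S, Schedule.IsShortest (Schedule.Delivers σ L x) S := by
  refine exists_shortest_of_closed _ x
    {z | (∀ t, |z.1 t - x| ≤ |t|) ∧ (∀ i, 0 ≤ z.2.1 i ∧ z.2.1 i ≤ z.2.2.2) ∧
      (∀ i, 0 ≤ z.2.2.1 i ∧ z.2.2.1 i ≤ z.2.2.2) ∧ 0 ≤ z.2.2.2 ∧
      (∀ s t, |z.1 t - z.1 s| ≤ |t - s|) ∧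
      (∀ i ∈ L, ∀ s, |z.1 s - σ.dst i| ≤ |s - z.2.2.1 i|) ∧
      (∀ s, |z.1 s - 0| ≤ |s - z.2.2.2|)} ?_ ?_ ?_ ?_ ?_
  · simp only [Set.ofPred_and, Set.ofPred_forall]
    repeat' first
      | apply IsClosed.inter
      | (apply isClosed_iInter; intro)
      | (apply isClosed_le <;> fun_prop)
  · exact fun z hz => ⟨hz.1, hz.2.1, hz.2.2.1, hz.2.2.2.1⟩
  · rintro z ⟨h1, h2, h3, h4, h5, h6, h7⟩
    refine ⟨⟨?_, ?_, h4⟩, fun i _ => (h3 i).1, fun i _ => (h3 i).2, ?_, ?_⟩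
    · have := h1 0; simpa [sub_eq_zero] using this
    · intro s t _ hst
      have := h5 s t; rwa [abs_of_nonneg (sub_nonneg.2 hst)] at this
    · intro i hi
      have := h6 i hi (z.2.2.1 i); simpa [sub_eq_zero] using this
    · have := h7 z.2.2.2; simpa [sub_eq_zero] using this
  · intro S hS
    have hsp : ∀ s t, 0 ≤ s → 0 ≤ t → |S.pos t - S.pos s| ≤ |t - s| := by
      intro s t hs ht
      rcases le_total s t with h | h
      · rw [abs_of_nonneg (sub_nonneg.2 h)]; exact hS.speed s t hs h
      · rw [abs_sub_comm, abs_sub_comm t, abs_of_nonneg (sub_nonneg.2 h)]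
        exact hS.speed t s ht h
    have hmx : ∀ s t : ℝ, |max t 0 - max s 0| ≤ |t - s| := fun s t => by
      simpa using abs_max_sub_max_le_max t 0 s 0
    classical
    refine ⟨⟨fun t => S.pos (max t 0), fun _ => 0, fun i => if i ∈ L then S.unload i else 0,
      S.finish⟩, ⟨?_, ?_, ?_, hS.finish_nonneg, ?_, ?_, ?_⟩, rfl⟩
    · intro t
      have := hsp 0 (max t 0) le_rfl (le_max_right _ _)
      rw [hS.start] at this
      exact this.trans (by simpa using hmx 0 t)
    · exact fun i => ⟨le_rfl, hS.finish_nonneg⟩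
    · intro i
      dsimp only
      split_ifs with hi
      · exact ⟨hS.unload_nonneg i hi, hS.unload_le_finish i hi⟩
      · exact ⟨le_rfl, hS.finish_nonneg⟩
    · exact fun s t => (hsp _ _ (le_max_right _ _) (le_max_right _ _)).trans (hmx s t)
    · intro i hi s
      have h0 := hS.unload_nonneg i hi
      simp only [if_pos hi]
      rw [← hS.pos_unload i hi]
      refine (hsp _ _ h0 (le_max_right _ _)).trans ?_
      simpa [max_eq_left h0] using hmx (S.unload i) s
    · intro s
      have h0 := hS.finish_nonneg
      have hf := hS.pos_finish
      change |S.pos (max s 0) - 0| ≤ |s - S.finish|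
      nth_rewrite 2 [← hf]
      refine (hsp _ _ h0 (le_max_right _ _)).trans ?_
      simpa [max_eq_left h0] using hmx S.finish s
  · set A := |x| + ∑ i, |σ.dst i| with hA
    have hdst : ∀ i, |σ.dst i| ≤ A := fun i =>
      (Finset.single_le_sum (f := fun i => |σ.dst i|) (fun _ _ => abs_nonneg _)
        (Finset.mem_univ i)).trans (le_add_of_nonneg_left (abs_nonneg x))
    have hx : |x| ≤ A := le_add_of_nonneg_right (Finset.sum_nonneg fun _ _ => abs_nonneg _)
    have hA0 : 0 ≤ A := (abs_nonneg x).trans hx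
    let p : ℕ → ℝ := fun k => if k = 0 then x else if h : k - 1 < σ.n then σ.dst ⟨k - 1, h⟩ else 0
    have hp : ∀ k, |p k| ≤ A := by
      intro k
      simp only [p]
      split_ifs
      · exact hx
      · exact hdst _
      · simpa using hA0
    obtain ⟨g, hg, hgp⟩ := exists_path (2 * A + 1) (by linarith) p (fun k m => by
      have := abs_sub (p k) (p m); linarith [hp k, hp m])
    have hD : 0 < 2 * A + 1 := by linarith
    refine ⟨⟨g, fun _ => 0, fun i => ((i : ℕ) + 1 : ℕ) * (2 * A + 1),
      (σ.n + 1 : ℕ) * (2 * A + 1)⟩, ⟨?_, fun s t _ h => hg s t h, by positivity⟩,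
      fun i _ => by positivity, fun i _ => ?_, fun i _ => ?_, ?_⟩
    · simpa [p] using hgp 0
    · dsimp only
      have := i.2
      exact mul_le_mul_of_nonneg_right (Nat.cast_le.2 (by omega)) hD.le
    · exact (hgp _).trans (by simp [p])
    · exact (hgp _).trans (by simp [p])

theorem exists_sched (c : ℕ∞) (hc : 1 ≤ c) (σ : RequestSeq) (R : Finset (Fin σ.n)) (x : ℝ) :
    ∃ S, Schedule.IsShortest (Schedule.Serves c σ (fun _ => 0) R x) S := by
  classical
  refine exists_shortest_of_closed _ x
    {z | (∀ t, |z.1 t - x| ≤ |t|) ∧ (∀ i, 0 ≤ z.2.1 i ∧ z.2.1 i ≤ z.2.2.2) ∧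
      (∀ i, 0 ≤ z.2.2.1 i ∧ z.2.2.1 i ≤ z.2.2.2) ∧ 0 ≤ z.2.2.2 ∧
      (∀ s t, |z.1 t - z.1 s| ≤ |t - s|) ∧
      (∀ i ∈ R, ∀ s, |z.1 s - σ.src i| ≤ |s - z.2.1 i|) ∧
      (∀ i ∈ R, ∀ s, |z.1 s - σ.dst i| ≤ |s - z.2.2.1 i|) ∧
      (∀ i ∈ R, z.2.1 i ≤ z.2.2.1 i) ∧
      (∀ J : Finset (Fin σ.n), J ⊆ R → c < (J.card : ℕ∞) →
        z ∈ ⋃ i ∈ J, ⋃ j ∈ J, {z | z.2.2.1 j ≤ z.2.1 i}) ∧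
      (∀ i ∈ R, ∀ J : Finset (Fin σ.n), J ⊆ R → c ≤ (J.card : ℕ∞) →
        z ∈ ⋃ j ∈ J, ({z | z.2.1 i ≤ z.2.1 j} ∪ {z | z.2.2.1 j ≤ z.2.1 i}))} ?_ ?_ ?_ ?_ ?_
  · simp only [Set.ofPred_and, Set.ofPred_forall, Set.ofPred_mem_eq]
    repeat' first
      | apply IsClosed.inter
      | apply IsClosed.union
      | (apply isClosed_iInter; intro)
      | (apply isClosed_le <;> fun_prop)
      | (apply isClosed_biUnion_finset; intros)
  · exact fun z hz => ⟨hz.1, hz.2.1, hz.2.2.1, hz.2.2.2.1⟩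
  · rintro z ⟨h1, h2, h3, h4, h5, h6, h7, h8, h9, h10⟩
    refine ⟨⟨?_, ?_, h4⟩, fun i _ => (h2 i).1, fun i _ => (h2 i).1, h8, fun i _ => (h3 i).2,
      ?_, ?_, ?_, ?_⟩
    · have := h1 0; simpa [sub_eq_zero] using this
    · intro s t _ hst
      have := h5 s t; rwa [abs_of_nonneg (sub_nonneg.2 hst)] at this
    · intro i hi
      have := h6 i hi (z.2.1 i); simpa [sub_eq_zero] using this
    · intro i hi
      have := h7 i hi (z.2.2.1 i); simpa [sub_eq_zero] using this
    · intro t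
      by_contra! hlt
      have := h9 _ (Finset.filter_subset _ _) hlt
      simp only [Set.mem_iUnion, Finset.mem_filter, Set.mem_ofPred_eq] at this
      obtain ⟨i, hi, j, hj, hij⟩ := this
      linarith [hi.2.1, hj.2.2]
    · intro i hi
      by_contra! hlt
      have := h10 i hi _ (Finset.filter_subset _ _) hlt
      simp only [Set.mem_iUnion, Finset.mem_filter, Set.mem_ofPred_eq, Set.mem_union] at this
      obtain ⟨j, hj, hij⟩ := this
      rcases hij with h | h
      · linarith [hj.2.1]
      · linarith [hj.2.2]
  · intro S hS
    have hsp : ∀ s t, 0 ≤ s → 0 ≤ t → |S.pos t - S.pos s| ≤ |t - s| := by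
      intro s t hs ht
      rcases le_total s t with h | h
      · rw [abs_of_nonneg (sub_nonneg.2 h)]; exact hS.speed s t hs h
      · rw [abs_sub_comm, abs_sub_comm t, abs_of_nonneg (sub_nonneg.2 h)]
        exact hS.speed t s ht h
    have hmx : ∀ s t : ℝ, |max t 0 - max s 0| ≤ |t - s| := fun s t => by
      simpa using abs_max_sub_max_le_max t 0 s 0
    have hu : ∀ i ∈ R, 0 ≤ S.unload i := fun i hi =>
      (hS.load_nonneg i hi).trans (hS.load_le_unload i hi)
    refine ⟨⟨fun t => S.pos (max t 0), fun i => if i ∈ R then S.load i else 0,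
      fun i => if i ∈ R then S.unload i else 0,
      S.finish⟩, ⟨?_, ?_, ?_, hS.finish_nonneg, ?_, ?_, ?_, ?_, ?_, ?_⟩, rfl⟩
    · intro t
      have := hsp 0 (max t 0) le_rfl (le_max_right _ _)
      rw [hS.start] at this
      exact this.trans (by simpa using hmx 0 t)
    · intro i
      dsimp only
      split_ifs with hi
      · exact ⟨hS.load_nonneg i hi, (hS.load_le_unload i hi).trans (hS.unload_le_finish i hi)⟩
      · exact ⟨le_rfl, hS.finish_nonneg⟩
    · intro i
      dsimp only
      split_ifs with hi
      · exact ⟨hu i hi, hS.unload_le_finish i hi⟩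
      · exact ⟨le_rfl, hS.finish_nonneg⟩
    · exact fun s t => (hsp _ _ (le_max_right _ _) (le_max_right _ _)).trans (hmx s t)
    · intro i hi s
      have h0 := hS.load_nonneg i hi
      simp only [if_pos hi]
      rw [← hS.pos_load i hi]
      refine (hsp _ _ h0 (le_max_right _ _)).trans ?_
      simpa [max_eq_left h0] using hmx (S.load i) s
    · intro i hi s
      have h0 := hu i hi
      simp only [if_pos hi]
      rw [← hS.pos_unload i hi]
      refine (hsp _ _ h0 (le_max_right _ _)).trans ?_
      simpa [max_eq_left h0] using hmx (S.unload i) s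
    · intro i hi
      simpa [if_pos hi] using hS.load_le_unload i hi
    · intro J hJ hcJ
      by_contra hno
      simp only [Set.mem_iUnion, Set.mem_ofPred_eq, not_exists, not_le] at hno
      have hJne : J.Nonempty := by
        rw [Finset.nonempty_iff_ne_empty]; rintro rfl; simp at hcJ
      obtain ⟨i, hi, him⟩ := J.exists_max_image S.load hJne
      have hsub : J ⊆ R.filter fun j => S.load j ≤ S.load i ∧ S.load i < S.unload j := by
        intro j hj
        have := hno i hi j hj
        rw [if_pos (hJ hi), if_pos (hJ hj)] at this
        exact Finset.mem_filter.2 ⟨hJ hj, him j hj, this⟩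
      have h1 := hS.capacity (S.load i)
      have h2 : (J.card : ℕ∞) ≤ _ := Nat.cast_le.2 (Finset.card_le_card hsub)
      exact absurd (hcJ.trans_le (h2.trans h1)) (lt_irrefl _)
    · intro i hi J hJ hcJ
      by_contra hno
      simp only [Set.mem_iUnion, Set.mem_ofPred_eq, not_exists, not_le, Set.mem_union,
        not_or] at hno
      have hsub : J ⊆ R.filter fun j => S.load j < S.load i ∧ S.load i < S.unload j := by
        intro j hj
        have := hno j hj
        rw [if_pos hi, if_pos (hJ hj), if_pos (hJ hj)] at this
        exact Finset.mem_filter.2 ⟨hJ hj, this⟩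
      have h1 := hS.room i hi
      have h2 : (J.card : ℕ∞) ≤ _ := Nat.cast_le.2 (Finset.card_le_card hsub)
      exact absurd (h1.trans_le (hcJ.trans h2)) (lt_irrefl _)
  · set A := |x| + ∑ i, (|σ.src i| + |σ.dst i|) with hA
    have hsd : ∀ i, |σ.src i| + |σ.dst i| ≤ A := fun i =>
      (Finset.single_le_sum (f := fun i => |σ.src i| + |σ.dst i|) (fun _ _ => by positivity)
        (Finset.mem_univ i)).trans (le_add_of_nonneg_left (abs_nonneg x))
    have hx : |x| ≤ A := le_add_of_nonneg_right (Finset.sum_nonneg fun _ _ => by positivity)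
    have hA0 : 0 ≤ A := (abs_nonneg x).trans hx
    let p : ℕ → ℝ := fun k => if k = 0 then x else
      if h : (k - 1) / 2 < σ.n then
        (if (k - 1) % 2 = 0 then σ.src ⟨(k - 1) / 2, h⟩ else σ.dst ⟨(k - 1) / 2, h⟩) else 0
    have hp : ∀ k, |p k| ≤ A := by
      intro k
      simp only [p]
      split_ifs with h1 h2
      · exact hx
      · linarith [hsd ⟨(k - 1) / 2, h2⟩, abs_nonneg (σ.dst ⟨(k - 1) / 2, h2⟩)]
      · linarith [hsd ⟨(k - 1) / 2, h2⟩, abs_nonneg (σ.src ⟨(k - 1) / 2, h2⟩)]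
      · simpa using hA0
    have hD : 0 < 2 * A + 1 := by linarith
    obtain ⟨g, hg, hgp⟩ := exists_path (2 * A + 1) hD p (fun k m => by
      have := abs_sub (p k) (p m); linarith [hp k, hp m])
    have hlt : ∀ k m : ℕ, (k : ℝ) * (2 * A + 1) < m * (2 * A + 1) ↔ k < m := fun k m => by
      rw [mul_lt_mul_iff_left₀ hD, Nat.cast_lt]
    refine ⟨⟨g, fun i => (2 * (i : ℕ) + 1 : ℕ) * (2 * A + 1),
      fun i => (2 * (i : ℕ) + 2 : ℕ) * (2 * A + 1),
      (2 * σ.n + 1 : ℕ) * (2 * A + 1)⟩, ⟨?_, fun s t _ h => hg s t h, by positivity⟩,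
      fun i _ => by positivity, fun i _ => by positivity, fun i _ => ?_, fun i _ => ?_,
      fun i _ => ?_, fun i _ => ?_, ?_, ?_⟩
    · simpa [p] using hgp 0
    · dsimp only
      gcongr
      omega
    · have := i.2
      exact mul_le_mul_of_nonneg_right (Nat.cast_le.2 (by omega)) hD.le
    · exact (hgp _).trans (by simp [p])
    · refine (hgp _).trans ?_
      have : (2 * (i : ℕ) + 1) / 2 = i := by omega
      simp [p, this]
    · intro t
      refine le_trans ?_ hc
      rw [Nat.cast_le_one, Finset.card_le_one]
      intro a ha b hb
      simp only [Finset.mem_filter] at ha hb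
      have h1 := (hlt _ _).1 (ha.2.1.trans_lt hb.2.2)
      have h2 := (hlt _ _).1 (hb.2.1.trans_lt ha.2.2)
      ext; omega
    · intro i hi
      refine lt_of_lt_of_le ?_ hc
      rw [Nat.cast_lt_one, Finset.card_eq_zero, Finset.filter_eq_empty_iff]
      rintro j - ⟨h1, h2⟩
      rw [hlt] at h1 h2
      omega

/-- Shortest schedules always exist, so there is a way of choosing among them. -/
theorem TieBreaking.nonempty (c : ℕ∞) (hc : 1 ≤ c) : Nonempty (TieBreaking c) := by
  choose f hf using exists_sched c hc
  choose g hg using exists_back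
  exact ⟨⟨f, g, hf, hg⟩⟩

end DialARide

end

namespace DialARide

/-! The adversary punishes the online server for going right before it goes left. Take `u` slightly
larger than `α`, and `a = α / 2`. Offline, moving to `-u` and then steadily right serves everything:
`-u` is reached at its release `u`, the transports `-a → 0` and `0 → 1` lie on the way, and `2` is
reached at `2u + 2`, when the last request appears there.

Online, the server leaves `0` with the first request at a time in `[α, u)`, before it knows about
`-u`. Having to unload in `1`, it cannot be back in the origin in time, so later arrivals do not
divert it (`step_carrying`). Idle in `1`, it waits at least until `α * (2u + 2)`. Going left first
would cost `3 + 2u`; since `2a < u`, every shortest schedule is `1 → 2 → -a → 0 → -u`, of length `3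
+ 2a + u` (`sched_middle`). The transport from `-a` costs the server an extra `2a`, while it is free
offline. The second request in `2` arrives after this schedule has been fixed, so that another `u +
2` is spent from `-u` (`le_of_completedBy`).

The ratio is at least `α + (5 + 2a + 2u) / (2u + 2)`, which tends to `2 + α + (1 - α) / (2 + 2α)` as
`u → α`. This is at least the claimed bound.

For large `α`, revealing the first request in `2` during the trip to `1` might send the server back.
It is then withheld until the wait in `1` ends, which gives the two cases
`exists_idleInOne_of_carrying` and `exists_idleInOne_of_waiting`. -/

theorem State.mem_loadedAt_follow {n m : ℕ} {R L V : Finset (Fin n)} {S : Schedule n} {s p t : ℝ}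
    {i : Fin n} :
    i ∈ (⟨m, .followSchedule R S, s, p, L, V⟩ : State n).loadedAt t ↔
      i ∈ R ∧ s + S.load i ≤ t ∧ t < s + S.unload i :=
  Finset.mem_filter

theorem State.mem_servedAt_follow {n m : ℕ} {R L V : Finset (Fin n)} {S : Schedule n} {s p t : ℝ}
    {i : Fin n} :
    i ∈ (⟨m, .followSchedule R S, s, p, L, V⟩ : State n).servedAt t ↔
      i ∈ V ∨ i ∈ R ∧ s + S.unload i ≤ t := by
  simp [State.servedAt]

/-! ### Event-by-event evaluation of the algorithm. -/

section Algorithm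

variable {c : ℕ∞} (τ : TieBreaking c) (α : ℝ) (σ : RequestSeq)

theorem step_of_request {q : State σ.n} (h : q.arrived < σ.n)
    (hle : (σ.release ⟨q.arrived, h⟩ : WithTop ℝ) ≤ q.endTime) :
    step τ α σ q = uponRequest τ α σ (σ.release ⟨q.arrived, h⟩) q := by
  unfold step
  rw [dif_pos ⟨h, hle⟩]

theorem step_of_idle {q : State σ.n} {e : ℝ} (he : q.endTime = e)
    (hno : ∀ h : q.arrived < σ.n, e < σ.release ⟨q.arrived, h⟩) :
    step τ α σ q = uponIdle τ α σ e q := by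
  unfold step
  rw [dif_neg, dif_neg]
  · congr 1
    simp [he]
  · simp [he]
  · rintro ⟨h, hle⟩
    rw [he, WithTop.coe_le_coe] at hle
    exact (hno h).not_ge hle

theorem uponRequest_of_busy {q : State σ.n} {t : ℝ}
    (hret : α * opt c σ t < t + (τ.back σ (q.loadedAt t) (q.posAt t)).finish)
    (hcmd : q.cmd ≠ .rest) :
    uponRequest τ α σ t q = { q with arrived := q.arrived + 1 } := by
  unfold uponRequest
  rw [if_neg hret.not_ge]
  split
  · contradiction
  · rfl

theorem arrived_uponIdle (t : ℝ) (q : State σ.n) :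
    (uponIdle τ α σ t q).arrived = q.arrived := by
  unfold uponIdle
  split_ifs <;> rfl

theorem arrived_le_step (q : State σ.n) : q.arrived ≤ (step τ α σ q).arrived := by
  unfold step
  split_ifs
  · unfold uponRequest
    dsimp only
    split_ifs
    · exact Nat.le_succ _
    · split
      · rw [arrived_uponIdle]
        exact Nat.le_succ _
      · exact Nat.le_succ _
  · exact le_rfl
  · rw [arrived_uponIdle]

theorem run_succ (k : ℕ) : run τ α σ (k + 1) = step τ α σ (run τ α σ k) :=
  Function.iterate_succ_apply' _ _ _

theorem run_add (k m : ℕ) : run τ α σ (k + m) = (step τ α σ)^[m] (run τ α σ k) := by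
  unfold run
  rw [add_comm, Function.iterate_add_apply]

theorem arrived_run_mono : Monotone fun k => (run τ α σ k).arrived :=
  monotone_nat_of_le_succ fun k => by
    rw [run_succ]
    exact arrived_le_step τ α σ _

theorem uponIdle_eq_follow {t p : ℝ} {m : ℕ} {q : State σ.n} {U L V : Finset (Fin σ.n)}
    (hw : α * opt c σ t ≤ t)
    (hm : q.arrived = m) (hp : q.posAt t = p) (hL : q.loadedAt t = L) (hV : q.servedAt t = V)
    (hU : (Finset.univ.filter fun i : Fin σ.n => (i : ℕ) < m) \ V = U) (hne : U ≠ ∅) :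
    uponIdle τ α σ t q = ⟨m, .followSchedule U (τ.sched σ U p), t, p, L, V⟩ := by
  have hun : q.unservedAt t = U := by rw [State.unservedAt, hm, hV, hU]
  rw [uponIdle, if_neg hw.not_gt, if_pos (by rw [hun]; exact hne), hun, hp, State.execute, hm, hp,
    hL, hV]

theorem uponIdle_eq_wait {t p : ℝ} {m : ℕ} {q : State σ.n} {L V : Finset (Fin σ.n)}
    (hw : t < α * opt c σ t)
    (hm : q.arrived = m) (hp : q.posAt t = p) (hL : q.loadedAt t = L) (hV : q.servedAt t = V) :
    uponIdle τ α σ t q = ⟨m, .waitUntil (α * opt c σ t), t, p, L, V⟩ := by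
  rw [uponIdle, if_pos hw, State.execute, hm, hp, hL, hV]

/-- A server that becomes idle with unserved requests starts serving them as soon as the waiting
time is over, provided that nothing arrives until then. -/
theorem uponIdle_reaches_follow {t T p : ℝ} {m : ℕ} {q : State σ.n} {U L V : Finset (Fin σ.n)}
    (hT : T = max t (α * opt c σ t)) (hopt : opt c σ T = opt c σ t)
    (hno : ∀ h : q.arrived < σ.n, T < σ.release ⟨q.arrived, h⟩)
    (hm : q.arrived = m) (hp : q.posAt t = p) (hL : q.loadedAt t = L) (hV : q.servedAt t = V)
    (hU : (Finset.univ.filter fun i : Fin σ.n => (i : ℕ) < m) \ V = U) (hne : U ≠ ∅) :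
    ∃ j, (step τ α σ)^[j] (uponIdle τ α σ t q) =
      ⟨m, .followSchedule U (τ.sched σ U p), T, p, L, V⟩ := by
  rcases lt_or_ge t (α * opt c σ t) with hw | hw
  · have hT' : T = α * opt c σ t := hT.trans (max_eq_right hw.le)
    refine ⟨1, ?_⟩
    rw [Function.iterate_one, uponIdle_eq_wait τ α σ hw hm hp hL hV, ← hT',
      step_of_idle τ α σ (e := T) rfl (by subst hm; exact hno)]
    exact uponIdle_eq_follow τ α σ (by rw [hopt, ← hT']) rfl rfl rfl rfl hU hne
  · have hT' : T = t := hT.trans (max_eq_left hw)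
    refine ⟨0, ?_⟩
    rw [Function.iterate_zero, id, hT']
    exact uponIdle_eq_follow τ α σ hw hm hp hL hV hU hne

theorem start_uponIdle (t : ℝ) (q : State σ.n) : (uponIdle τ α σ t q).start = t := by
  unfold uponIdle
  split_ifs <;> rfl

theorem le_endTime_uponIdle (t : ℝ) (q : State σ.n) :
    (t : WithTop ℝ) ≤ (uponIdle τ α σ t q).endTime := by
  unfold uponIdle
  split_ifs with h1
  · exact WithTop.coe_le_coe.2 h1.le
  · have := (τ.sched_shortest σ (q.unservedAt t) (q.posAt t)).1.finish_nonneg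
    exact WithTop.coe_le_coe.2 (le_add_of_nonneg_right this)
  · exact le_top

/-- Once all requests have arrived, no command is issued before the current one was completed. -/
theorem le_start_iterate_step {B : ℝ} {q : State σ.n} (hq : σ.n ≤ q.arrived)
    (hB : (B : WithTop ℝ) ≤ q.endTime) (m : ℕ) :
    σ.n ≤ ((step τ α σ)^[m] q).arrived ∧ (B : WithTop ℝ) ≤ ((step τ α σ)^[m] q).endTime ∧
      ((step τ α σ)^[m] q = q ∨ B ≤ ((step τ α σ)^[m] q).start) := by
  -- The bound on `endTime` is carried along because each new command starts at the end of the
  -- previous one.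
  induction m with
  | zero => exact ⟨hq, hB, Or.inl rfl⟩
  | succ m ih =>
    rw [Function.iterate_succ_apply']
    obtain ⟨h1, h2, h3⟩ := ih
    generalize (step τ α σ)^[m] q = q' at *
    rcases he : q'.endTime with _ | e
    · have : step τ α σ q' = q' := by
        unfold step
        rw [dif_neg (fun h => h1.not_gt h.1), dif_pos (show q'.endTime = ⊤ from he)]
      rw [this]
      exact ⟨h1, h2, h3⟩
    · have he' : q'.endTime = (e : WithTop ℝ) := he
      rw [step_of_idle τ α σ he' (fun h => absurd h h1.not_gt), arrived_uponIdle, start_uponIdle]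
      rw [he', WithTop.coe_le_coe] at h2
      exact ⟨h1, (WithTop.coe_le_coe.2 h2).trans (le_endTime_uponIdle τ α σ e q'), Or.inr h2⟩

end Algorithm

/-! ### Elementary bounds for schedules and for the offline optimum. -/

section Schedules

theorem Schedule.IsMotion.abs_sub_le {n : ℕ} {S : Schedule n} {x : ℝ} (hS : S.IsMotion x) {t : ℝ}
    (ht : 0 ≤ t) : |S.pos t - x| ≤ t := by
  have := hS.speed 0 t le_rfl ht
  rwa [hS.start, sub_zero] at this

/-- The destination has to be visited before the final return, so the two speed bounds add up. -/
theorem Schedule.Delivers.le_finish {σ : RequestSeq} {L : Finset (Fin σ.n)} {x : ℝ}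
    {S : Schedule σ.n} (hS : S.Delivers σ L x) {i : Fin σ.n} (hi : i ∈ L) :
    |σ.dst i - x| + |σ.dst i| ≤ S.finish := by
  have h1 := hS.abs_sub_le (hS.unload_nonneg i hi)
  have h2 := hS.speed _ _ (hS.unload_nonneg i hi) (hS.unload_le_finish i hi)
  rw [hS.pos_unload i hi] at h1 h2
  rw [hS.pos_finish, zero_sub, abs_neg] at h2
  linarith

theorem Schedule.Delivers.abs_le_finish {σ : RequestSeq} {L : Finset (Fin σ.n)} {x : ℝ}
    {S : Schedule σ.n} (hS : S.Delivers σ L x) : |x| ≤ S.finish := by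
  have h1 := hS.abs_sub_le hS.finish_nonneg
  rwa [hS.pos_finish, zero_sub, abs_neg] at h1

theorem finish_back_empty {c : ℕ∞} (τ : TieBreaking c) (σ : RequestSeq) :
    (τ.back σ ∅ 0).finish = 0 := by
  obtain ⟨h1, h2⟩ := τ.back_shortest σ ∅ 0
  refine le_antisymm (h2 ⟨fun _ => 0, fun _ => 0, fun _ => 0, 0⟩ ?_) h1.finish_nonneg
  exact ⟨⟨rfl, fun s t _ h => by simpa using h, le_rfl⟩, by simp, by simp, by simp, rfl⟩

theorem optOf_le {c : ℕ∞} {σ : RequestSeq} {R : Finset (Fin σ.n)} {S : Schedule σ.n}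
    (hS : S.Serves c σ σ.release R 0) : optOf c σ R ≤ S.finish :=
  csInf_le ⟨0, by rintro _ ⟨S', hS', rfl⟩; exact hS'.finish_nonneg⟩ ⟨S, hS, rfl⟩

theorem le_optOf {c : ℕ∞} {σ : RequestSeq} {R : Finset (Fin σ.n)} {B : ℝ}
    (hne : ∃ S : Schedule σ.n, S.Serves c σ σ.release R 0)
    (h : ∀ S : Schedule σ.n, S.Serves c σ σ.release R 0 → B ≤ S.finish) : B ≤ optOf c σ R := by
  obtain ⟨S, hS⟩ := hne
  refine le_csInf ⟨_, S, hS, rfl⟩ ?_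
  rintro _ ⟨S', hS', rfl⟩
  exact h S' hS'

end Schedules

/-- A server that never carries two requests respects every capacity. -/
theorem capacity_of_disjoint {n : ℕ} {c : ℕ∞} (hc : 1 ≤ c) {R : Finset (Fin n)} {S : Schedule n}
    (h : ∀ t, ∀ i ∈ R, ∀ j ∈ R, S.load i ≤ t → t < S.unload i → S.load j ≤ t → t < S.unload j →
      i = j) (t : ℝ) :
    ((R.filter fun j => S.load j ≤ t ∧ t < S.unload j).card : ℕ∞) ≤ c := by
  refine le_trans ?_ hc
  rw [Nat.cast_le_one, Finset.card_le_one]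
  intro i hi j hj
  simp only [Finset.mem_filter] at hi hj
  exact h t i hi.1 j hj.1 hi.2.1 hi.2.2 hj.2.1 hj.2.2

theorem room_of_disjoint {n : ℕ} {c : ℕ∞} (hc : 1 ≤ c) {R : Finset (Fin n)} {S : Schedule n}
    {i : Fin n} (h : ∀ j ∈ R, S.load j < S.load i → S.unload j ≤ S.load i) :
    ((R.filter fun j => S.load j < S.load i ∧ S.load i < S.unload j).card : ℕ∞) < c := by
  refine lt_of_lt_of_le ?_ hc
  rw [Nat.cast_lt_one, Finset.card_eq_zero, Finset.filter_eq_empty_iff]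
  rintro j hj ⟨h1, h2⟩
  exact (h j hj h1).not_gt h2

/-! ### The adversarial sequence and its offline optima. -/

/-- The parameters of the adversarial request sequence. -/
structure Adversary where
  u : ℝ
  a : ℝ
  t₀ : ℝ
  t₂ : ℝ
  t₃ : ℝ
  t₀_pos : 0 < t₀
  t₀_lt : t₀ < u
  lt_t₂ : u < t₂
  t₂_lt : t₂ < t₃
  t₃_lt : t₃ < 2 * u + 2
  a_nonneg : 0 ≤ a
  -- The third request is known when the offline server passes `-a` on its way right.
  t₂_le : t₂ ≤ 2 * u - a
  -- Makes ending in `-u` strictly shorter than ending in `2` for a server in `1`.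
  two_a_lt : 2 * a < u
  -- Makes it optimal offline to visit `-u` before `1`.
  u_le_one : u ≤ 1

namespace Adversary

variable (P : Adversary)

/-- The requests `(0, 1; t₀)`, `(-u, -u; u)`, `(-a, 0; t₂)`, `(2, 2; t₃)`, `(2, 2; 2u + 2)`. -/
abbrev seq : RequestSeq where
  n := 5
  src := ![0, -P.u, -P.a, 2, 2]
  dst := ![1, -P.u, 0, 2, 2]
  release := ![P.t₀, P.u, P.t₂, P.t₃, 2 * P.u + 2]
  release_pos := by
    have h1 := P.t₀_pos
    have h2 := P.t₀_lt
    have h3 := P.lt_t₂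
    have h4 := P.t₂_lt
    intro i
    fin_cases i <;> simp <;> linarith
  release_strictMono := by
    have h1 := P.t₀_pos
    have h2 := P.t₀_lt
    have h3 := P.lt_t₂
    have h4 := P.t₂_lt
    have h5 := P.t₃_lt
    rw [Fin.strictMono_iff_lt_succ]
    intro i
    fin_cases i <;> simp <;> linarith

/-- The offline schedule that moves to `-u` and then to the right. -/
def offline (T : ℝ) : Schedule 5 where
  -- The server is in `-u` at time `u`, and from then on in `x ≥ -u` at time `2u + x`.
  pos t := |t - P.u| - P.u
  load := ![2 * P.u, P.u, 2 * P.u - P.a, 2 * P.u + 2, 2 * P.u + 2]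
  unload := ![2 * P.u + 1, P.u, 2 * P.u, 2 * P.u + 2, 2 * P.u + 2]
  -- The end is left free so that the same motion bounds the optimum of every subset of the
  -- requests.
  finish := T

variable {c : ℕ∞}

theorem offline_serves (hc : 1 ≤ c) {R : Finset (Fin 5)} {T : ℝ}
    (hR : ∀ i ∈ R, (P.offline T).unload i ≤ T) (hT : 0 ≤ T) :
    (P.offline T).Serves c P.seq P.seq.release R 0 := by
  obtain ⟨u, a, t₀, t₂, t₃, h0, h1, h2, h3, h4, h5, h6, h7, h8⟩ := P
  have hu : 0 < u := h0.trans h1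
  refine ⟨⟨?_, ?_, hT⟩, ?_, ?_, ?_, hR, ?_, ?_, ?_, ?_⟩
  · simp [offline, abs_of_pos hu]
  · intro s t _ hst
    have := abs_abs_sub_abs_le (t - u) (s - u)
    rw [show t - u - (s - u) = t - s by ring, abs_of_nonneg (sub_nonneg.2 hst)] at this
    simpa [offline] using this
  · intro i _
    fin_cases i <;> simp [offline] <;> linarith
  · intro i _
    fin_cases i <;> simp [offline] <;> linarith
  · intro i _
    fin_cases i <;> simp [offline] <;> linarith
  · intro i _
    fin_cases i <;> simp [offline]
    · rw [abs_of_nonneg] <;> linarith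
    · rw [abs_of_nonneg] <;> linarith
    · rw [abs_of_nonneg] <;> linarith
    · rw [abs_of_nonneg] <;> linarith
  · intro i _
    fin_cases i <;> simp [offline]
    · rw [abs_of_nonneg] <;> linarith
    · rw [abs_of_nonneg] <;> linarith
    · rw [abs_of_nonneg] <;> linarith
    · rw [abs_of_nonneg] <;> linarith
  · refine capacity_of_disjoint hc fun t i _ j _ => ?_
    fin_cases i <;> fin_cases j <;> simp [offline] <;> intros <;> linarith
  · refine fun i _ => room_of_disjoint hc fun j _ => ?_
    fin_cases i <;> fin_cases j <;> simp [offline] <;> intros <;> linarith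

theorem u_pos : 0 < P.u := P.t₀_pos.trans P.t₀_lt

theorem exists_serves (hc : 1 ≤ c) (R : Finset (Fin 5)) :
    ∃ S : Schedule 5, S.Serves c P.seq P.seq.release R 0 := by
  have hu := P.u_pos
  refine ⟨_, P.offline_serves hc (T := 2 * P.u + 2) (fun i _ => ?_) (by linarith)⟩
  fin_cases i <;> simp [offline] <;> linarith

theorem optOf_le_all (hc : 1 ≤ c) (R : Finset (Fin 5)) : optOf c P.seq R ≤ 2 * P.u + 2 := by
  have hu := P.u_pos
  refine optOf_le (P.offline_serves hc (T := 2 * P.u + 2) (fun i _ => ?_) (by linarith))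
  fin_cases i <;> simp [offline] <;> linarith

theorem optOf_le_of_lt_three (hc : 1 ≤ c) {R : Finset (Fin 5)} (hR : ∀ i ∈ R, i < 3) :
    optOf c P.seq R ≤ 2 * P.u + 1 := by
  have hu := P.u_pos
  refine optOf_le (P.offline_serves hc (T := 2 * P.u + 1) (fun i hi => ?_) (by linarith))
  have := hR i hi
  fin_cases i <;> simp [offline] at this ⊢ <;> linarith

theorem optOf_zero_le (hc : 1 ≤ c) : optOf c P.seq {0} ≤ P.t₀ + 1 := by
  have h0 := P.t₀_pos
  refine optOf_le (S := ⟨fun t => max (t - P.t₀) 0, fun _ => P.t₀, fun _ => P.t₀ + 1, P.t₀ + 1⟩)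
    ⟨⟨?_, ?_, by positivity⟩, ?_, ?_, ?_, ?_, ?_, ?_, ?_, ?_⟩
  · simpa using h0.le
  · intro s t _ hst
    have := abs_max_sub_max_le_max (t - P.t₀) 0 (s - P.t₀) 0
    rw [show t - P.t₀ - (s - P.t₀) = t - s by ring, abs_of_nonneg (sub_nonneg.2 hst)] at this
    simpa [hst] using this
  · simpa using h0.le
  · simp
  · simp
  · simp
  · simp
  · simp
  · refine capacity_of_disjoint hc fun t i hi j hj _ _ _ _ => ?_
    rw [Finset.mem_singleton.1 hi, Finset.mem_singleton.1 hj]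
  · exact fun i _ => room_of_disjoint hc fun j _ h => absurd h (lt_irrefl _)

theorem one_le_optOf (hc : 1 ≤ c) {R : Finset (Fin 5)} (hR : 0 ∈ R) : 1 ≤ optOf c P.seq R := by
  refine le_optOf (P.exists_serves hc R) fun S hS => ?_
  have h1 := hS.load_nonneg 0 hR
  have h2 := hS.load_le_unload 0 hR
  have h3 := (abs_le.1 (hS.abs_sub_le (h1.trans h2))).2
  have h4 := hS.unload_le_finish 0 hR
  rw [hS.pos_unload 0 hR] at h3
  simp at h3
  linarith

/-- Visiting both `-u` after its release and some `z ≥ 1` takes until `2u + z`. -/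
theorem le_optOf_of_visit (hc : 1 ≤ c) {R : Finset (Fin 5)} {i : Fin 5} {z : ℝ} (h1R : 1 ∈ R)
    (hiR : i ∈ R) (hz : P.seq.dst i = z) (hz1 : 1 ≤ z) : 2 * P.u + z ≤ optOf c P.seq R := by
  refine le_optOf (P.exists_serves hc R) fun S hS => ?_
  have hu := P.u_pos
  have hu1 := P.u_le_one
  have a1 := hS.rel_le_load 1 h1R
  have a2 := hS.pos_load 1 h1R
  have a3 := (hS.load_le_unload 1 h1R).trans (hS.unload_le_finish 1 h1R)
  have b1 := (hS.load_nonneg i hiR).trans (hS.load_le_unload i hiR)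
  have b2 := hS.pos_unload i hiR
  have b3 := hS.unload_le_finish i hiR
  have a0 := hS.load_nonneg 1 h1R
  rw [hz] at b2
  simp at a1 a2
  rcases le_total (S.load 1) (S.unload i) with h | h
  · have := (abs_le.1 (hS.speed _ _ a0 h)).2
    rw [a2, b2] at this
    linarith
  -- If `z` comes first, `-u` is reached no earlier than `2z + u`, which is no better since `u ≤ 1 ≤
  -- z`.
  · have h5 := (abs_le.1 (hS.speed _ _ b1 h)).1
    have h6 := (abs_le.1 (hS.abs_sub_le b1)).2
    rw [a2, b2] at h5
    rw [b2] at h6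
    linarith

/-! ### Shortest schedules that the algorithm may follow. -/

/-- The direct trip has length `1`, which leaves no slack for the loading and unloading times: they
are the same for every tie-breaking. -/
theorem sched_zero (hc : 1 ≤ c) (τ : TieBreaking c) :
    (τ.sched P.seq {0} 0).load 0 = 0 ∧ (τ.sched P.seq {0} 0).unload 0 = 1 ∧
      (τ.sched P.seq {0} 0).finish = 1 ∧ (τ.sched P.seq {0} 0).pos 1 = 1 := by
  obtain ⟨hS, hmin⟩ := τ.sched_shortest P.seq {0} 0
  have hle := hmin ⟨fun t => t, fun _ => 0, fun _ => 1, 1⟩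
    ⟨⟨rfl, fun s t _ h => (abs_of_nonneg (sub_nonneg.2 h)).le, zero_le_one⟩, by simp, by simp,
      by simp, by simp, by simp, by simp,
      capacity_of_disjoint hc fun t i hi j hj _ _ _ _ => by
        rw [Finset.mem_singleton.1 hi, Finset.mem_singleton.1 hj],
      fun i _ => room_of_disjoint hc fun j _ h => absurd h (lt_irrefl _)⟩
  generalize τ.sched P.seq {0} 0 = S at *
  have m0 : (0 : Fin 5) ∈ ({0} : Finset (Fin 5)) := Finset.mem_singleton_self _
  have h1 := hS.load_nonneg 0 m0
  have h2 := hS.load_le_unload 0 m0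
  have h3 := (abs_le.1 (hS.speed _ _ h1 h2)).2
  have h4 := hS.unload_le_finish 0 m0
  have h5 := hS.pos_unload 0 m0
  rw [h5, hS.pos_load 0 m0] at h3
  simp at h3 hle h5
  have hU : S.unload 0 = 1 := by linarith
  rw [hU] at h5
  exact ⟨by linarith, hU, by linarith, h5⟩

theorem pos_sched_zero_le (τ : TieBreaking c) {t : ℝ} (ht : 0 ≤ t) :
    (τ.sched P.seq {0} 0).pos t ≤ t := by
  have := (abs_le.1 ((τ.sched_shortest P.seq {0} 0).1.abs_sub_le ht)).2
  linarith

/-- The schedule `1 → 2 → -a → 0 → -u`. -/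
def detour : Schedule 5 where
  -- Two tents: the first peaks in `2` at time `1`, the second in `0` at time `3 + 2a`. They cross
  -- in `-a` at time `3 + a`.
  pos t := max (2 - |t - 1|) (-|t - (3 + 2 * P.a)|)
  -- The entries for the requests `0` and `4` are placeholders.
  load := ![0, 3 + 2 * P.a + P.u, 3 + P.a, 1, 0]
  unload := ![0, 3 + 2 * P.a + P.u, 3 + 2 * P.a, 1, 0]
  finish := 3 + 2 * P.a + P.u

theorem detour_serves (hc : 1 ≤ c) :
    P.detour.Serves c P.seq (fun _ => 0) {1, 2, 3} 1 := by
  obtain ⟨u, a, t₀, t₂, t₃, h0, h1, h2, h3, h4, h5, h6, h7, h8⟩ := P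
  have hu : 0 < u := h0.trans h1
  have hmem : ∀ i ∈ ({1, 2, 3} : Finset (Fin 5)), i = 1 ∨ i = 2 ∨ i = 3 := by simp
  refine ⟨⟨?_, ?_, ?_⟩, ?_, ?_, ?_, ?_, ?_, ?_, ?_, ?_⟩
  · have := abs_nonneg (-(2 * a) + -3)
    simp [detour]
    norm_num
    linarith
  · intro s t _ hst
    refine (abs_max_sub_max_le_max _ _ _ _).trans (max_le ?_ ?_)
    · have := abs_abs_sub_abs_le (s - 1) (t - 1)
      rw [show s - 1 - (t - 1) = -(t - s) by ring, abs_neg, abs_of_nonneg (sub_nonneg.2 hst)] at this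
      rwa [show 2 - |t - 1| - (2 - |s - 1|) = |s - 1| - |t - 1| by ring]
    · have := abs_abs_sub_abs_le (s - (3 + 2 * a)) (t - (3 + 2 * a))
      rw [show s - (3 + 2 * a) - (t - (3 + 2 * a)) = -(t - s) by ring, abs_neg,
        abs_of_nonneg (sub_nonneg.2 hst)] at this
      rwa [show -|t - (3 + 2 * a)| - -|s - (3 + 2 * a)| =
        |s - (3 + 2 * a)| - |t - (3 + 2 * a)| by ring]
  · simp [detour]; linarith
  · intro i hi
    rcases hmem i hi with rfl | rfl | rfl <;> simp [detour] <;> linarith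
  · intro i hi
    rcases hmem i hi with rfl | rfl | rfl <;> simp [detour] <;> linarith
  · intro i hi
    rcases hmem i hi with rfl | rfl | rfl <;> simp [detour] <;> linarith
  · intro i hi
    rcases hmem i hi with rfl | rfl | rfl <;> simp [detour] <;> linarith
  · intro i hi
    rcases hmem i hi with rfl | rfl | rfl <;> simp [detour]
    · rw [abs_of_nonneg (by linarith), abs_of_nonneg (by linarith), max_eq_right] <;> linarith
    · rw [abs_of_nonneg (by linarith), abs_of_nonpos (by linarith), max_eq_right] <;> linarith
    · linarith [abs_nonneg (1 - (3 + 2 * a))]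
  · intro i hi
    rcases hmem i hi with rfl | rfl | rfl <;> simp [detour]
    · rw [abs_of_nonneg (by linarith), abs_of_nonneg (by linarith), max_eq_right] <;> linarith
    · rw [abs_of_nonneg (by linarith)]; linarith
    · linarith [abs_nonneg (1 - (3 + 2 * a))]
  · refine capacity_of_disjoint hc fun t i hi j hj => ?_
    rcases hmem i hi with rfl | rfl | rfl <;> rcases hmem j hj with rfl | rfl | rfl <;>
      simp [detour] <;> intros <;> linarith
  · refine fun i hi => room_of_disjoint hc fun j hj => ?_
    rcases hmem i hi with rfl | rfl | rfl <;> rcases hmem j hj with rfl | rfl | rfl <;>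
      simp [detour] <;> intros <;> linarith

/-- Every shortest schedule from `1` for the middle requests ends in `-u`. -/
theorem sched_middle (hc : 1 ≤ c) (τ : TieBreaking c) :
    (τ.sched P.seq {1, 2, 3} 1).finish = 3 + 2 * P.a + P.u ∧
      (τ.sched P.seq {1, 2, 3} 1).pos (3 + 2 * P.a + P.u) = -P.u ∧
      ∀ i ∈ ({1, 2, 3} : Finset (Fin 5)),
        (τ.sched P.seq {1, 2, 3} 1).unload i ≤ 3 + 2 * P.a + P.u := by
  obtain ⟨hS, hmin⟩ := τ.sched_shortest P.seq {1, 2, 3} 1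
  have hle : _ ≤ 3 + 2 * P.a + P.u := hmin _ (P.detour_serves hc)
  generalize τ.sched P.seq {1, 2, 3} 1 = S at *
  obtain ⟨u, a, t₀, t₂, t₃, h0, h1, h2, h3, h4, h5, h6, h7, h8⟩ := P
  have hu : 0 < u := h0.trans h1
  have m1 : (1 : Fin 5) ∈ ({1, 2, 3} : Finset (Fin 5)) := by simp
  have m2 : (2 : Fin 5) ∈ ({1, 2, 3} : Finset (Fin 5)) := by simp
  have m3 : (3 : Fin 5) ∈ ({1, 2, 3} : Finset (Fin 5)) := by simp
  have p1 := hS.pos_load 1 m1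
  have p2 := hS.pos_load 2 m2
  have q2 := hS.pos_unload 2 m2
  have p3 := hS.pos_load 3 m3
  have n1 := hS.load_nonneg 1 m1
  have n2 := hS.load_nonneg 2 m2
  have n3 := hS.load_nonneg 3 m3
  have l2 := hS.load_le_unload 2 m2
  have f1 := (hS.load_le_unload 1 m1).trans (hS.unload_le_finish 1 m1)
  have f2 := hS.unload_le_finish 2 m2
  have f3 := (hS.load_le_unload 3 m3).trans (hS.unload_le_finish 3 m3)
  have s1 := abs_le.1 (hS.abs_sub_le n1)
  have s2 := abs_le.1 (hS.abs_sub_le n2)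
  have s3 := abs_le.1 (hS.abs_sub_le n3)
  have s22 := abs_le.1 (hS.speed _ _ n2 l2)
  simp at p1 p2 q2 p3 hle
  rw [p1] at s1
  rw [p2] at s2
  rw [p3] at s3
  rw [p2, q2] at s22
  -- Visiting `-u` before `2`, or after `2` but before the delivery in `0`, takes at least `3 + 2u`,
  -- which is too long as `2a < u`. So `-u` comes last, and both remaining orders of `2` and `-a`
  -- give the bound.
  have key : 3 + 2 * a + u ≤ S.load 1 := by
    rcases le_total (S.load 1) (S.load 3) with h | h
    · have := abs_le.1 (hS.speed _ _ n1 h)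
      rw [p1, p3] at this
      linarith
    have h31 := abs_le.1 (hS.speed _ _ n3 h)
    rw [p1, p3] at h31
    rcases le_total (S.load 1) (S.unload 2) with h' | h'
    · have := abs_le.1 (hS.speed _ _ n1 h')
      rw [p1, q2] at this
      linarith
    have h21 := abs_le.1 (hS.speed _ _ (n2.trans l2) h')
    rw [p1, q2] at h21
    rcases le_total (S.load 3) (S.load 2) with h'' | h''
    · have := abs_le.1 (hS.speed _ _ n3 h'')
      rw [p2, p3] at this
      linarith
    · have := abs_le.1 (hS.speed _ _ n2 h'')
      rw [p2, p3] at this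
      linarith
  have hL : S.load 1 = 3 + 2 * a + u := by linarith
  rw [hL] at p1
  exact ⟨by dsimp only; linarith, p1, fun i hi => (hS.unload_le_finish i hi).trans hle⟩

theorem le_unload_sched_last (τ : TieBreaking c) :
    P.u + 2 ≤ (τ.sched P.seq {4} (-P.u)).unload 4 ∧
      P.u + 2 ≤ (τ.sched P.seq {4} (-P.u)).finish := by
  have hS := (τ.sched_shortest P.seq {4} (-P.u)).1
  have m4 : (4 : Fin 5) ∈ ({4} : Finset (Fin 5)) := Finset.mem_singleton_self _
  have h := (hS.load_nonneg 4 m4).trans (hS.load_le_unload 4 m4)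
  have h1 := (abs_le.1 (hS.abs_sub_le h)).2
  have h2 := hS.unload_le_finish 4 m4
  rw [hS.pos_unload 4 m4] at h1
  simp at h1
  constructor <;> linarith

end Adversary

/-! ### The run of the algorithm on the adversarial sequence. -/

namespace Adversary

variable (P : Adversary) {c : ℕ∞} (τ : TieBreaking c) (α : ℝ)

theorem opt_eq_zero_only {t : ℝ} (h0 : P.t₀ ≤ t) (h1 : t < P.u) :
    opt c P.seq t = optOf c P.seq {0} := by
  have h3 := P.lt_t₂
  have h4 := P.t₂_lt
  have h5 := P.t₃_lt
  unfold opt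
  congr 1
  ext i
  fin_cases i <;> simp <;> linarith

theorem opt_le_all (hc : 1 ≤ c) (t : ℝ) : opt c P.seq t ≤ 2 * P.u + 2 := P.optOf_le_all hc _

theorem opt_le_of_lt (hc : 1 ≤ c) {t : ℝ} (ht : t < P.t₃) : opt c P.seq t ≤ 2 * P.u + 1 := by
  refine P.optOf_le_of_lt_three hc fun i hi => ?_
  have h5 := P.t₃_lt
  rw [Finset.mem_filter] at hi
  have hi := hi.2
  fin_cases i <;> simp at hi ⊢ <;> linarith

theorem one_le_opt (hc : 1 ≤ c) {t : ℝ} (ht : P.t₀ ≤ t) : 1 ≤ opt c P.seq t :=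
  P.one_le_optOf hc (Finset.mem_filter.2 ⟨Finset.mem_univ _, ht⟩)

theorem le_opt_of_le (hc : 1 ≤ c) {t : ℝ} (ht : P.u ≤ t) : 2 * P.u + 1 ≤ opt c P.seq t :=
  P.le_optOf_of_visit hc (i := 0) (Finset.mem_filter.2 ⟨Finset.mem_univ _, ht⟩)
    (Finset.mem_filter.2 ⟨Finset.mem_univ _, P.t₀_lt.le.trans ht⟩) rfl le_rfl

theorem opt_eq_of_le (hc : 1 ≤ c) {t : ℝ} (ht : P.t₃ ≤ t) : opt c P.seq t = 2 * P.u + 2 :=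
  le_antisymm (P.opt_le_all hc t) <|
    P.le_optOf_of_visit hc (i := 3)
      (Finset.mem_filter.2 ⟨Finset.mem_univ _, (P.lt_t₂.trans P.t₂_lt).le.trans ht⟩)
      (Finset.mem_filter.2 ⟨Finset.mem_univ _, ht⟩) rfl one_le_two

/-- The time at which the server starts serving the first request. -/
noncomputable def firstStart (c : ℕ∞) : ℝ := max P.t₀ (α * opt c P.seq P.t₀)

/-- The server is serving the first request, and `m` requests have arrived. -/
noncomputable def carrying (m : ℕ) : State 5 :=
  ⟨m, .followSchedule {0} (τ.sched P.seq {0} 0), P.firstStart α c, 0, ∅, ∅⟩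

variable {P α}

theorem le_firstStart (hc : 1 ≤ c) (h0 : 0 ≤ α) : α ≤ P.firstStart α c :=
  (le_mul_of_one_le_right h0 (P.one_le_opt hc le_rfl)).trans (le_max_right _ _)

/-- This commits the server to the trip to `1` before the request in `-u` is known; it rests on
`Opt(t₀) ≤ t₀ + 1`. -/
theorem firstStart_lt (hc : 1 ≤ c) (h0 : 0 ≤ α) (hu : α * (P.t₀ + 1) < P.u) :
    P.firstStart α c < P.u := by
  refine max_lt P.t₀_lt (lt_of_le_of_lt ?_ hu)
  rw [P.opt_eq_zero_only le_rfl P.t₀_lt]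
  exact mul_le_mul_of_nonneg_left (P.optOf_zero_le hc) h0

theorem exists_run_eq_carrying_one (hc : 1 ≤ c) (h0 : 0 ≤ α)
    (hu : α * (P.t₀ + 1) < P.u) : ∃ k, run τ α P.seq k = P.carrying τ α 1 := by
  have hlt := firstStart_lt hc h0 hu
  have hle : P.t₀ ≤ P.firstStart α c := le_max_left _ _
  have idle : ∀ q : State 5, q.arrived = 1 → q.posAt P.t₀ = 0 → q.loadedAt P.t₀ = ∅ →
      q.servedAt P.t₀ = ∅ → ∃ j, (step τ α P.seq)^[j] (uponIdle τ α P.seq P.t₀ q) =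
        P.carrying τ α 1 := by
    intro q hm hp hL hV
    refine uponIdle_reaches_follow τ α P.seq (T := P.firstStart α c) rfl ?_ ?_ hm hp hL hV ?_ ?_
    · rw [P.opt_eq_zero_only hle hlt, P.opt_eq_zero_only le_rfl P.t₀_lt]
    · intro h
      simp only [hm]
      exact hlt
    · ext i
      fin_cases i <;> simp
    · simp
  have h1 : run τ α P.seq 1 = uponRequest τ α P.seq P.t₀ (initState 5) :=
    step_of_request τ α P.seq (q := initState 5) (Nat.zero_lt_succ 4) le_top
  -- An empty server in the origin returns in time `0`, so both branches leave it idle there at time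
  -- `t₀`.
  by_cases hret : P.t₀ + (τ.back P.seq ∅ 0).finish ≤ α * opt c P.seq P.t₀
  · have h2 : run τ α P.seq 1 =
        (⟨1, .deliverAndReturn (τ.back P.seq ∅ 0), P.t₀, 0, ∅, ∅⟩ : State 5) := by
      rw [h1]
      exact if_pos hret
    have h3 : run τ α P.seq 2 = uponIdle τ α P.seq P.t₀
        (⟨1, .deliverAndReturn (τ.back P.seq ∅ 0), P.t₀, 0, ∅, ∅⟩ : State 5) := by
      rw [run_succ, h2]
      refine step_of_idle τ α P.seq ?_ fun _ => P.t₀_lt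
      refine congrArg (fun x : ℝ => (x : WithTop ℝ)) ?_
      exact (congrArg (P.t₀ + ·) (finish_back_empty τ P.seq)).trans (add_zero _)
    obtain ⟨j, hj⟩ := idle ⟨1, .deliverAndReturn (τ.back P.seq ∅ 0), P.t₀, 0, ∅, ∅⟩ rfl
      (by simpa [State.posAt] using (τ.back_shortest P.seq ∅ 0).1.start)
      (by simp [State.loadedAt]) (by simp [State.servedAt])
    exact ⟨2 + j, by rw [run_add, h3, hj]⟩
  · have h2 : run τ α P.seq 1 = uponIdle τ α P.seq P.t₀ { initState 5 with arrived := 1 } := by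
      rw [h1]
      exact if_neg hret
    obtain ⟨j, hj⟩ := idle { initState 5 with arrived := 1 } rfl rfl rfl rfl
    exact ⟨1 + j, by rw [run_add, h2, hj]⟩

/-- The server must still unload in `1`, which it cannot reach before `firstStart + 1`, and then
come back. The origin is thus out of reach before `firstStart + 2`, and `hret` excludes an abort. -/
theorem step_carrying (hc : 1 ≤ c) {m : ℕ} (hm : m < 5)
    (hlo : P.firstStart α c ≤ P.seq.release ⟨m, hm⟩)
    (hhi : P.seq.release ⟨m, hm⟩ < P.firstStart α c + 1)
    (hret : α * opt c P.seq (P.seq.release ⟨m, hm⟩) < 2 + P.firstStart α c) :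
    step τ α P.seq (P.carrying τ α m) = P.carrying τ α (m + 1) := by
  obtain ⟨e1, e2, e3, -⟩ := P.sched_zero hc τ
  have hle : (P.seq.release ⟨m, hm⟩ : WithTop ℝ) ≤ (P.carrying τ α m).endTime := by
    exact WithTop.coe_le_coe.2 (hhi.le.trans_eq (congrArg (P.firstStart α c + ·) e3.symm))
  rw [step_of_request τ α P.seq (q := P.carrying τ α m) hm hle]
  refine uponRequest_of_busy τ α P.seq (q := P.carrying τ α m) ?_ (by simp [carrying])
  change α * opt c P.seq (P.seq.release ⟨m, hm⟩) < P.seq.release ⟨m, hm⟩ +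
    (τ.back P.seq ((P.carrying τ α m).loadedAt (P.seq.release ⟨m, hm⟩))
      ((P.carrying τ α m).posAt (P.seq.release ⟨m, hm⟩))).finish
  generalize P.seq.release ⟨m, hm⟩ = t at *
  have hmem : (0 : Fin 5) ∈ (P.carrying τ α m).loadedAt t := by
    rw [carrying, State.mem_loadedAt_follow, e1, e2, add_zero]
    exact ⟨Finset.mem_singleton_self _, hlo, hhi⟩
  have hb := (τ.back_shortest P.seq ((P.carrying τ α m).loadedAt t)
    ((P.carrying τ α m).posAt t)).1.le_finish hmem
  have hp : (P.carrying τ α m).posAt t ≤ t - P.firstStart α c :=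
    P.pos_sched_zero_le τ (sub_nonneg.2 hlo)
  have h1 := le_abs_self (P.seq.dst 0 - (P.carrying τ α m).posAt t)
  have h2 := le_abs_self (P.seq.dst 0)
  have h3 : P.seq.dst 0 = 1 := rfl
  rw [h3] at h1 h2 hb
  linarith

theorem carrying_completed (hc : 1 ≤ c) (m : ℕ) :
    (P.carrying τ α m).endTime = (P.firstStart α c + 1 : ℝ) ∧
      (P.carrying τ α m).posAt (P.firstStart α c + 1) = 1 ∧
      (P.carrying τ α m).loadedAt (P.firstStart α c + 1) = ∅ ∧
      (P.carrying τ α m).servedAt (P.firstStart α c + 1) = {0} := by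
  obtain ⟨e1, e2, e3, e4⟩ := P.sched_zero hc τ
  refine ⟨?_, ?_, ?_, ?_⟩
  · simp only [State.endTime, carrying]
    rw [e3]
  · simp only [State.posAt, carrying]
    rw [add_sub_cancel_left, e4]
  · refine Finset.eq_empty_of_forall_notMem fun i hi => ?_
    rw [carrying, State.mem_loadedAt_follow] at hi
    obtain ⟨hi, -, h⟩ := hi
    rw [Finset.mem_singleton.1 hi, e2] at h
    exact lt_irrefl _ h
  · ext i
    rw [carrying, State.mem_servedAt_follow]
    constructor
    · exact fun h => h.elim (fun h => absurd h (Finset.notMem_empty _)) And.left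
    · intro h
      refine Or.inr ⟨h, ?_⟩
      rw [Finset.mem_singleton.1 h, e2]

variable (P α)

/-- After `k` events the server is idle in `1` at time `w`, has served exactly the first request, and
all but the last request have arrived. -/
def IdleInOne (k : ℕ) (w : ℝ) : Prop :=
  ∃ q : State 5, run τ α P.seq k = uponIdle τ α P.seq w q ∧ q.arrived = 4 ∧ q.posAt w = 1 ∧
    q.loadedAt w = ∅ ∧ q.servedAt w = {0} ∧ P.t₃ ≤ w ∧ w < 2 * P.u + 2

variable {P α}

/-- The case that the fourth request arrives while the server carries the first one. -/
theorem exists_idleInOne_of_carrying (hc : 1 ≤ c) (h0 : 0 ≤ α) (hu : α * (P.t₀ + 1) < P.u)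
    (h3 : P.t₃ < α + 1) (hret : α * (2 * P.u + 2) < 2 + α) : ∃ k w, P.IdleInOne τ α k w := by
  have hlt := firstStart_lt hc h0 hu
  have hα := le_firstStart (P := P) hc h0
  have l2 := P.lt_t₂
  have l3 := P.t₂_lt
  have hno : ∀ t, α * opt c P.seq t < 2 + P.firstStart α c := fun t => by
    have := mul_le_mul_of_nonneg_left (P.opt_le_all hc t) h0
    linarith
  obtain ⟨k, hk⟩ := exists_run_eq_carrying_one τ hc h0 hu
  have e1 : P.seq.release ⟨1, by simp⟩ = P.u := rfl
  have e2 : P.seq.release ⟨2, by simp⟩ = P.t₂ := rfl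
  have e3 : P.seq.release ⟨3, by simp⟩ = P.t₃ := rfl
  have hk3 : run τ α P.seq (k + 3) = P.carrying τ α 4 := by
    rw [run_succ, run_succ, run_succ, hk,
      step_carrying τ hc (m := 1) (by simp) (by linarith) (by linarith) (hno _),
      step_carrying τ hc (m := 2) (by simp) (by linarith) (by linarith) (hno _),
      step_carrying τ hc (m := 3) (by simp) (by linarith) (by linarith) (hno _)]
  obtain ⟨f1, f2, f3, f4⟩ := carrying_completed (P := P) (α := α) τ hc 4
  refine ⟨k + 4, P.firstStart α c + 1, P.carrying τ α 4, ?_, rfl, f2, f3, f4, by linarith,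
    by linarith [P.u_pos]⟩
  rw [run_succ, hk3]
  refine step_of_idle τ α P.seq f1 fun _ => ?_
  change _ < 2 * P.u + 2
  linarith [P.u_pos]

/-- The case that the fourth request arrives while the server waits in `1`. -/
theorem exists_idleInOne_of_waiting (hc : 1 ≤ c) (h0 : 0 ≤ α) (h1 : α < 1)
    (hu : α * (P.t₀ + 1) < P.u) (h3 : P.t₃ = α * (2 * P.u + 1)) (h3' : P.u + 1 ≤ P.t₃)
    (h2 : P.t₂ < α + 1) (hret : α * (2 * P.u + 1) < 2 + α) : ∃ k w, P.IdleInOne τ α k w := by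
  have hlt := firstStart_lt hc h0 hu
  have hα := le_firstStart (P := P) hc h0
  have l2 := P.lt_t₂
  have l3 := P.t₂_lt
  have hno : ∀ t < P.t₃, α * opt c P.seq t < 2 + P.firstStart α c := fun t ht => by
    have := mul_le_mul_of_nonneg_left (P.opt_le_of_lt hc ht) h0
    linarith
  obtain ⟨k, hk⟩ := exists_run_eq_carrying_one τ hc h0 hu
  have e1 : P.seq.release ⟨1, by simp⟩ = P.u := rfl
  have e2 : P.seq.release ⟨2, by simp⟩ = P.t₂ := rfl
  have e3 : P.seq.release ⟨3, by simp⟩ = P.t₃ := rfl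
  have hk2 : run τ α P.seq (k + 2) = P.carrying τ α 3 := by
    rw [run_succ, run_succ, hk,
      step_carrying τ hc (m := 1) (by simp) (by linarith) (by linarith) (hno _ (by linarith)),
      step_carrying τ hc (m := 2) (by simp) (by linarith) (by linarith) (hno _ (by linarith))]
  obtain ⟨f1, f2, f3, f4⟩ := carrying_completed (P := P) (α := α) τ hc 3
  set s := P.firstStart α c + 1 with hs
  have hopt : opt c P.seq s = 2 * P.u + 1 :=
    le_antisymm (P.opt_le_of_lt hc (by linarith)) (P.le_opt_of_le hc (by linarith [P.u_le_one]))
  have hw : α * opt c P.seq s = P.t₃ := by rw [hopt, h3]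
  have hk3 : run τ α P.seq (k + 3) = (⟨3, .waitUntil P.t₃, s, 1, ∅, {0}⟩ : State 5) := by
    rw [run_succ, hk2, step_of_idle τ α P.seq f1 fun _ => ?_]
    · rw [← hw]
      exact uponIdle_eq_wait τ α P.seq (by rw [hw]; linarith) rfl f2 f3 f4
    · change s < P.t₃
      linarith
  have hk4 : run τ α P.seq (k + 4) = (⟨4, .waitUntil P.t₃, s, 1, ∅, {0}⟩ : State 5) := by
    rw [run_succ, hk3, step_of_request τ α P.seq (by simp) le_rfl]
    refine uponRequest_of_busy τ α P.seq ?_ (by simp)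
    -- Returning from `1` takes time `1`, but the new request raises `α * Opt` above `t₃` only by `α
    -- < 1`.
    have hb := (τ.back_shortest P.seq ∅ 1).1.abs_le_finish
    change α * opt c P.seq P.t₃ < P.t₃ + (τ.back P.seq ∅ 1).finish
    rw [P.opt_eq_of_le hc le_rfl]
    rw [abs_one] at hb
    linarith
  refine ⟨k + 5, P.t₃, ⟨4, .waitUntil P.t₃, s, 1, ∅, {0}⟩, ?_, rfl, rfl, rfl, rfl, le_rfl, P.t₃_lt⟩
  rw [run_succ, hk4]
  exact step_of_idle τ α P.seq rfl fun _ => P.t₃_lt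

/-- The three summands are the wait in `1`, the schedule that ends in `-u`, and the trip from there
to the last request in `2`. -/
theorem le_of_completedBy (hc : 1 ≤ c) (h1 : α < 1) {k : ℕ} {w : ℝ}
    (hk : P.IdleInOne τ α k w) {t : ℝ} (ht : CompletedBy τ α P.seq t) :
    α * (2 * P.u + 2) + (3 + 2 * P.a + P.u) + (P.u + 2) ≤ t := by
  obtain ⟨q, hq, qm, qp, qL, qV, hw3, hw⟩ := hk
  have hupos := P.u_pos
  have ha := P.a_nonneg
  have hut : P.u < P.t₃ := P.lt_t₂.trans P.t₂_lt
  have hαu : α * (2 * P.u + 2) < 2 * P.u + 2 := by nlinarith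
  set T := max w (α * opt c P.seq w) with hT
  have hwT : w ≤ T := le_max_left _ _
  have hαT : α * (2 * P.u + 2) ≤ T := by
    rw [hT, P.opt_eq_of_le hc hw3]
    exact le_max_right _ _
  -- The schedule is fixed before the last request appears, so it cannot include it.
  have hT' : T < 2 * P.u + 2 := by
    rw [hT, P.opt_eq_of_le hc hw3]
    exact max_lt hw hαu
  obtain ⟨j, hj⟩ := uponIdle_reaches_follow τ α P.seq (U := ({1, 2, 3} : Finset (Fin 5))) hT
    (by rw [P.opt_eq_of_le hc hw3, P.opt_eq_of_le hc (hw3.trans hwT)])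
    (fun h => by simp only [qm]; exact hT') qm qp qL qV
    (by ext i; fin_cases i <;> simp) (by simp)
  rw [← hq, ← run_add] at hj
  obtain ⟨x1, x2, x3⟩ := P.sched_middle hc τ
  set S := τ.sched P.seq {1, 2, 3} 1
  set X := 3 + 2 * P.a + P.u with hX
  have hI : run τ α P.seq (k + j + 1) =
      (⟨5, .followSchedule {1, 2, 3} S, T, 1, ∅, {0}⟩ : State 5) := by
    -- The last request arrives while the schedule is running: `T ≥ t₃ > u`, and the schedule takes
    -- at least `3 + u`.
    have hle : ((2 * P.u + 2 : ℝ) : WithTop ℝ) ≤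
        (⟨4, .followSchedule {1, 2, 3} S, T, 1, ∅, {0}⟩ : State 5).endTime := by
      refine WithTop.coe_le_coe.2 ?_
      rw [x1]
      linarith
    rw [run_succ, hj, step_of_request τ α P.seq (by simp) hle]
    -- The deadline `α * (2u + 2)` for a return has passed already, whatever is on board.
    refine uponRequest_of_busy τ α P.seq (lt_of_lt_of_le (b := 2 * P.u + 2) ?_ ?_) (by simp)
    · change α * opt c P.seq (2 * P.u + 2) < _
      rwa [P.opt_eq_of_le hc P.t₃_lt.le]
    · exact le_add_of_nonneg_right (τ.back_shortest P.seq _ _).1.finish_nonneg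
  have hJ : run τ α P.seq (k + j + 2) =
      (⟨5, .followSchedule {4} (τ.sched P.seq {4} (-P.u)), T + X, -P.u, ∅, {0, 1, 2, 3}⟩ :
        State 5) := by
    rw [run_succ, hI, step_of_idle τ α P.seq (e := T + X) ?_ fun h => absurd h (lt_irrefl _)]
    · refine uponIdle_eq_follow τ α P.seq ?_ rfl ?_ ?_ ?_ ?_ ?_
      · rw [P.opt_eq_of_le hc (by linarith)]
        linarith
      · simp only [State.posAt]
        rw [add_sub_cancel_left, x2]
      · simp only [State.loadedAt]
        refine Finset.filter_eq_empty_iff.2 fun i hi h => ?_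
        linarith [x3 i hi, h.2]
      · simp only [State.servedAt]
        rw [Finset.filter_true_of_mem fun i hi => by linarith [x3 i hi]]
        rfl
      · ext i
        fin_cases i <;> simp
      · simp
    · simp only [State.endTime]
      rw [x1]
  obtain ⟨y1, y2⟩ := P.le_unload_sched_last τ
  obtain ⟨m, hm, hst, hsv⟩ := ht
  have h4 : (4 : Fin 5) ∈ (run τ α P.seq m).servedAt t := by
    rw [hsv]
    exact Finset.mem_univ _
  -- A state witnessing completion cannot precede the last arrival, nor lie in the middle schedule,
  -- which omits request `4`. Later it is either the final schedule, which unloads too late, or a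
  -- command that starts too late.
  rcases Nat.lt_or_ge m (k + j + 1) with h | h
  · have := arrived_run_mono τ α P.seq (Nat.lt_succ_iff.1 h)
    simp only [hm, hj] at this
    exact absurd this (by simp)
  rcases h.eq_or_lt with rfl | h
  · rw [hI] at h4
    simp [State.servedAt] at h4
  obtain ⟨l, rfl⟩ := Nat.exists_eq_add_of_le (Nat.succ_le_of_lt h)
  rw [run_add, show (k + j + 1).succ = k + j + 2 from rfl, hJ] at h4 hst
  have hB : ((T + X + (P.u + 2) : ℝ) : WithTop ℝ) ≤ (⟨5, .followSchedule {4}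
      (τ.sched P.seq {4} (-P.u)), T + X, -P.u, ∅, {0, 1, 2, 3}⟩ : State 5).endTime :=
    WithTop.coe_le_coe.2 (add_le_add_right y2 _)
  rcases (le_start_iterate_step τ α P.seq (le_refl 5) hB l).2.2 with h | h
  · rw [h] at h4
    simp [State.servedAt] at h4
    linarith
  · linarith

theorem le_lazyCost (hc : 1 ≤ c) (h1 : α < 1) {k : ℕ} {w : ℝ}
    (hk : P.IdleInOne τ α k w) :
    ENNReal.ofReal (α * (2 * P.u + 2) + (3 + 2 * P.a + P.u) + (P.u + 2)) ≤
      lazyCost τ α P.seq :=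
  le_iInf₂ fun _ ht => ENNReal.ofReal_le_ofReal (le_of_completedBy τ hc h1 hk ht)

end Adversary

/-! ### Choice of the parameters and passage to the limit. -/

namespace Adversary

variable {c : ℕ∞} (τ : TieBreaking c) {α : ℝ}

theorem le_competitiveRatio {P : Adversary} (hc : 1 ≤ c) (h1 : α < 1) {k : ℕ} {w : ℝ}
    (hk : P.IdleInOne τ α k w) :
    ENNReal.ofReal (α + (5 + 2 * P.a + 2 * P.u) / (2 * P.u + 2)) ≤ competitiveRatio τ α := by
  have hu : 0 < 2 * P.u + 2 := by linarith [P.u_pos]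
  refine le_trans ?_ (le_iSup₂ (f := fun (σ : RequestSeq) (_ : 0 < σ.n) =>
    lazyCost τ α σ / ENNReal.ofReal (optOf c σ Finset.univ)) P.seq (Nat.succ_pos 4))
  have hcost := le_lazyCost τ hc h1 hk
  refine le_trans ?_ (ENNReal.div_le_div hcost
    (ENNReal.ofReal_le_ofReal (P.optOf_le_all hc Finset.univ)))
  rw [← ENNReal.ofReal_div_of_pos hu]
  refine ENNReal.ofReal_le_ofReal (le_of_eq ?_)
  rw [eq_div_iff hu.ne', add_mul, div_mul_cancel₀ _ hu.ne']
  ring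

/-- The lower bound given by the adversary with `u = α + δ` and `a = α / 2`. -/
theorem le_competitiveRatio_of_small (hc : 1 ≤ c) (h0 : 0 ≤ α) {δ : ℝ} (hδ : 0 < δ)
    (hδ1 : δ < 1 - α) (hδ2 : δ < 1 / 12) :
    ENNReal.ofReal (α + (5 + 3 * α + 2 * δ) / (2 + 2 * α + 2 * δ)) ≤ competitiveRatio τ α := by
  suffices ∃ P : Adversary, P.u = α + δ ∧ P.a = α / 2 ∧ ∃ k w, P.IdleInOne τ α k w by
    obtain ⟨P, hu, ha, k, w, hk⟩ := this
    have h := le_competitiveRatio τ hc (by linarith) hk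
    rw [hu, ha] at h
    convert h using 4 <;> ring
  have h1 : α < 1 := by linarith
  have hmul : α * δ ≤ δ := by nlinarith
  -- An early fourth request needs `α * (2u + 2) < 2 + α`; for `α ≤ 3/4` this follows from `δ <
  -- 1/12`, with equality in the extreme case. The late one needs `u + 1 ≤ α * (2u + 1)`, that is `1
  -- + δ ≤ 2α² + 2αδ`, which holds for `α > 3/4`.
  rcases le_or_gt α (3 / 4) with hα | hα
  · refine ⟨⟨α + δ, α / 2, δ / 2, α + δ + δ / 2, α + δ + δ, by linarith, by linarith, by linarith,
      by linarith, by linarith, by linarith, by linarith, by linarith, by linarith⟩, rfl, rfl,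
      exists_idleInOne_of_carrying τ hc h0 ?_ ?_ ?_⟩
    · dsimp only
      nlinarith
    · dsimp only
      linarith
    · dsimp only
      nlinarith
  · refine ⟨⟨α + δ, α / 2, δ / 2, α + δ + δ / 2, α * (2 * (α + δ) + 1), by linarith, by linarith,
      by linarith, by nlinarith, by nlinarith, by linarith, by linarith, by linarith,
      by linarith⟩, rfl, rfl, exists_idleInOne_of_waiting τ hc h0 h1 ?_ rfl ?_ ?_ ?_⟩
    · dsimp only
      nlinarith
    · dsimp only
      nlinarith
    · dsimp only
      linarith
    · dsimp only
      nlinarith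

end Adversary

/-- The value at `δ = 0` is only approached: there `2a = u`, and the middle schedule could equally
well end in `2`. -/
theorem le_competitiveRatio_lazy {c : ℕ∞} (hc : 1 ≤ c) (τ : TieBreaking c) {α : ℝ} (h0 : 0 ≤ α)
    (h1 : α < 1) :
    ENNReal.ofReal (2 + α + (1 - α) / (2 + 2 * α)) ≤ competitiveRatio τ α := by
  have hlim : Filter.Tendsto
      (fun δ : ℝ => ENNReal.ofReal (α + (5 + 3 * α + 2 * δ) / (2 + 2 * α + 2 * δ)))
      (nhdsWithin 0 (Set.Ioi 0)) (nhds (ENNReal.ofReal (2 + α + (1 - α) / (2 + 2 * α)))) := by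
    refine (ENNReal.continuous_ofReal.tendsto _).comp (tendsto_nhdsWithin_of_tendsto_nhds ?_)
    have hne : 2 + 2 * α + 2 * (0 : ℝ) ≠ 0 := by positivity
    have hcont : ContinuousAt (fun δ : ℝ => α + (5 + 3 * α + 2 * δ) / (2 + 2 * α + 2 * δ)) 0 := by
      fun_prop (disch := exact hne)
    convert hcont.tendsto using 2
    field_simp
    ring
  refine le_of_tendsto hlim ?_
  have hpos : (0 : ℝ) < min (1 - α) (1 / 12) := lt_min (by linarith) (by norm_num)
  filter_upwards [Ioo_mem_nhdsGT hpos] with δ hδ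
  exact Adversary.le_competitiveRatio_of_small τ hc h0 hδ.1 (hδ.2.trans_le (min_le_left _ _))
    (hδ.2.trans_le (min_le_right _ _))

end DialARide

theorem proposition3 (c : ℕ∞) (hc : 1 ≤ c) (τ : DialARide.TieBreaking c)
    (α : ℝ) (hα : α ∈ Set.Ico (0 : ℝ) 1) :
    ENNReal.ofReal (2 + α + (1 - α) / (2 + 3 * α)) ≤ DialARide.competitiveRatio τ α := by
  obtain ⟨h0, h1⟩ := hα
  refine le_trans (ENNReal.ofReal_le_ofReal ?_) (DialARide.le_competitiveRatio_lazy hc τ h0 h1)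
  have : (1 - α) / (2 + 3 * α) ≤ (1 - α) / (2 + 2 * α) :=
    div_le_div_of_nonneg_left (by linarith) (by linarith) (by linarith)
  linarith
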